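/- Let $\mathcal E$ be a complex Hilbert space. For a Hilbert space $\mathcal X$ let $H^2_{\mathcal X}(\mathbb D)$ be the Hilbert space of $\mathcal X$-valued analytic functions on the open unit disc $\mathbb D$ with square-summable Taylor coefficients at $0$; for $A,B\in\mathcal B(\mathcal X)$ let $M_{A+Bz}$ be the operator $f(z)\mapsto (A+zB)f(z)$ on $H^2_{\mathcal X}(\mathbb D)$, and $M_z$ the operator $f(z)\mapsto zf(z)$. An inner function $(\mathcal E_*,\mathcal E,\Theta)$ is a bounded analytic function $\Theta:\mathbb D\to\mathcal B(\mathcal E_*,\mathcal E)$, $\mathcal E_*$ a Hilbert space, whose boundary values are isometric: for every $x\in\mathcal E_*$ and almost every $\theta$ the limit $\lim_{r\to1^-}\Theta(re^{i\theta})x$ exists and has norm $\|x\|$. It is a Beurling–Lax–Halmos representation of a closed subspace $\mathcal M\subseteq H^2_{\mathcal E}(\mathbb D)$ if $\mathcal M=\Theta H^2_{\mathcal E_*}(\mathbb D)$. A tetrablock unitary is a triple $(A,B,P)$ of commuting normal operators on a Hilbert space whose Taylor joint spectrum is contained in $$bE=\{(x_1,x_2,x_3)\in\mathbb C^3: x_1=\overline{x_2}\,x_3,\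 |x_3|=1,\ |x_2|\le 1\}.$$ A tetrablock isometry is (up to unitary equivalence) the restriction of a tetrablock unitary to a joint invariant subspace. **Theorem.** Let $F_1,F_2\in\mathcal B(\mathcal E)$, let $\mathcal M\neq\{0\}$ be a closed subspace of $H^2_{\mathcal E}(\mathbb D)$ and let $(\mathcal E_*,\mathcal E,\Theta)$ be a Beurling–Lax–Halmos representation of $\mathcal M$. Then $\mathcal M$ is invariant under each of $M_{F_1^*+F_2z}$, $M_{F_2^*+F_1z}$, $M_z$ if and only if there is a unique pair $G_1,G_2\in\mathcal B(\mathcal E_*)$ such that $$(F_1^*+F_2z)\Theta(z)=\Theta(z)(G_1+G_2^*z)\quad\text{and}\quad (F_2^*+F_1z)\Theta(z)=\Theta(z)(G_2+G_1^*z)\qquad\text{for all } z\in\mathbb D.$$ Moreover, for $G_1,G_2\in\mathcal B(\mathcal E_*)$ satisfying these two identities, if $(M_{F_1^*+F_2z},M_{F_2^*+F_1z},M_z)$ is a tetrablock isometry on $H^2_{\mathcal E}(\mathbb D)$, then $(M_{G_1+G_2^*z},M_{G_2+G_1^*z},M_z)$ is a tetrablock isometry on $H^2_{\mathcal E_*}(\mathbb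 D)$. -/

import Mathlib

open scoped ENNReal Topology InnerProduct

universe u

noncomputable section

/-! ### The vector-valued Hardy space of the disc -/

/-- `H²_E(𝔻)`: the Hilbert space of `E`-valued analytic functions on the unit disc with
square-summable Taylor coefficients at `0`. An element `f` is stored as its sequence `n ↦ f n` of
Taylor coefficients; the function itself is `Hardy.eval f`. -/
abbrev Hardy (E : Type u) [NormedAddCommGroup E] : Type u :=
  lp (fun _ : ℕ => E) 2

namespace Hardy

theorem summable_sq {E : Type u} [NormedAddCommGroup E] (f : Hardy E) :
    Summable (fun n : ℕ => ‖f n‖ ^ 2) := by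
  simpa using (lp.memℓp f).summable (by norm_num)

theorem norm_sq {E : Type u} [NormedAddCommGroup E] (f : Hardy E) :
    ‖f‖ ^ 2 = ∑' n : ℕ, ‖f n‖ ^ 2 := by
  simpa using lp.norm_rpow_eq_tsum (p := 2) (by norm_num) f

variable {E : Type u} [NormedAddCommGroup E] [InnerProductSpace ℂ E]

/-- The value `f(z) = ∑ zⁿ fₙ`; the series converges absolutely for `|z| < 1`
(`Hardy.summable_eval`). -/
def eval (f : Hardy E) (z : ℂ) : E :=
  ∑' n : ℕ, z ^ n • f n

theorem summable_norm_eval (f : Hardy E) {z : ℂ} (hz : z ∈ Metric.ball (0 : ℂ) 1) :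
    Summable (fun n : ℕ => ‖z ^ n • f n‖) := by
  have hz' : ‖z‖ < 1 := by simpa using hz
  refine Summable.of_nonneg_of_le (fun n => norm_nonneg _) (fun n => ?_)
    ((summable_geometric_of_lt_one (norm_nonneg z) hz').mul_right ‖f‖)
  rw [norm_smul, norm_pow]
  exact mul_le_mul_of_nonneg_left (lp.norm_apply_le_norm two_ne_zero f n) (by positivity)

theorem summable_eval [CompleteSpace E] (f : Hardy E) {z : ℂ}
    (hz : z ∈ Metric.ball (0 : ℂ) 1) : Summable (fun n : ℕ => z ^ n • f n) :=
  (summable_norm_eval f hz).of_norm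

/-- The coefficients of `z f(z)`. -/
def shiftSeq (f : ℕ → E) : ℕ → E
  | 0 => 0
  | n + 1 => f n

theorem memlp_shiftSeq {E : Type u} [NormedAddCommGroup E] (f : Hardy E) : Memℓp (shiftSeq f) 2 := by
  refine memℓp_gen ?_
  rw [← summable_nat_add_iff 1]
  simpa [shiftSeq] using summable_sq f

/-- The operator `M_z` of multiplication by the coordinate function on `H²_E(𝔻)`. -/
def Mz (E : Type u) [NormedAddCommGroup E] [InnerProductSpace ℂ E] : Hardy E →L[ℂ] Hardy E :=
  LinearMap.mkContinuous
    { toFun := fun f => ⟨shiftSeq f, memlp_shiftSeq f⟩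
      map_add' := fun f g => by
        ext n
        cases n with
        | zero => exact (add_zero (0 : E)).symm
        | succ n => rfl
      map_smul' := fun c f => by
        ext n
        cases n <;> simp [shiftSeq] }
    1 (fun f => by
      rw [one_mul]
      refine le_of_sq_le_sq ?_ (norm_nonneg _)
      rw [norm_sq, norm_sq, Summable.tsum_eq_zero_add (summable_sq _)]
      simp [shiftSeq])

@[simp]
theorem Mz_zero (f : Hardy E) : Mz E f 0 = 0 := rfl

@[simp]
theorem Mz_succ (f : Hardy E) (n : ℕ) : Mz E f (n + 1) = f n := rfl

theorem memlp_const (A : E →L[ℂ] E) (f : Hardy E) :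
    Memℓp (fun n : ℕ => A (f n)) 2 := by
  refine memℓp_gen ?_
  refine Summable.of_nonneg_of_le (fun n => by positivity) (fun n => ?_)
    ((summable_sq f).mul_left (‖A‖ ^ 2))
  have := pow_le_pow_left₀ (norm_nonneg _) (A.le_opNorm (f n)) 2
  simpa [mul_pow] using this

/-- Multiplication by the constant operator `A`, i.e. `I ⊗ A` on `H²(𝔻) ⊗ E`. -/
def Mconst (A : E →L[ℂ] E) : Hardy E →L[ℂ] Hardy E :=
  LinearMap.mkContinuous
    { toFun := fun f => ⟨fun n => A (f n), memlp_const A f⟩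
      map_add' := fun f g => by
        ext n
        exact A.map_add (f n) (g n)
      map_smul' := fun c f => by
        ext n
        simp }
    ‖A‖ (fun f => by
      refine le_of_sq_le_sq ?_ (by positivity)
      rw [mul_pow, norm_sq, norm_sq, ← tsum_mul_left]
      refine Summable.tsum_le_tsum (fun n => ?_) (summable_sq _) ((summable_sq f).mul_left _)
      have := pow_le_pow_left₀ (norm_nonneg _) (A.le_opNorm (f n)) 2
      simpa [mul_pow] using this)

@[simp]
theorem Mconst_apply (A : E →L[ℂ] E) (f : Hardy E) (n : ℕ) : Mconst A f n = A (f n) := rfl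

/-- The multiplication operator `M_{A + Bz}` on `H²_E(𝔻)`, for `A, B ∈ B(E)`. -/
def Mlin (A B : E →L[ℂ] E) : Hardy E →L[ℂ] Hardy E :=
  Mconst A + Mz E ∘L Mconst B

theorem eval_Mz [CompleteSpace E] (f : Hardy E) {z : ℂ} (hz : z ∈ Metric.ball (0 : ℂ) 1) :
    eval (Mz E f) z = z • eval f z := by
  unfold eval
  rw [(summable_eval _ hz).tsum_eq_zero_add, ← (summable_eval f hz).tsum_const_smul z]
  simp [pow_succ', mul_smul]

theorem eval_Mconst [CompleteSpace E] (A : E →L[ℂ] E) (f : Hardy E) {z : ℂ}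
    (hz : z ∈ Metric.ball (0 : ℂ) 1) : eval (Mconst A f) z = A (eval f z) := by
  unfold eval
  rw [A.map_tsum (summable_eval f hz)]
  simp

/-- `Mlin A B` is pointwise multiplication by the function `z ↦ A + z B`. -/
theorem eval_Mlin [CompleteSpace E] (A B : E →L[ℂ] E) (f : Hardy E) {z : ℂ}
    (hz : z ∈ Metric.ball (0 : ℂ) 1) :
    eval (Mlin A B f) z = (A + z • B) (eval f z) := by
  have h : eval (Mlin A B f) z = eval (Mconst A f) z + eval (Mz E (Mconst B f)) z := by
    unfold eval
    rw [← (summable_eval _ hz).tsum_add (summable_eval _ hz)]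
    simp [Mlin]
  rw [h, eval_Mz _ hz, eval_Mconst _ _ hz, eval_Mconst _ _ hz]
  simp

end Hardy

/-! ### Inner functions and Beurling–Lax–Halmos representations -/

section Inner

variable {E Estar : Type u}
  [NormedAddCommGroup E] [InnerProductSpace ℂ E]
  [NormedAddCommGroup Estar] [InnerProductSpace ℂ Estar]

/-- `(E_*, E, Θ)` is an inner function: a bounded analytic function on the disc with values in
`B(E_*, E)` whose (strong, radial) boundary values on the circle are isometries. The exceptional
null set may depend on the vector `x`; for separable `E_*` it can be chosen independently of `x`,
so that this says that `Θ(e^{iθ})` exists and is an isometry for almost every `θ`. Only the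
values of `Θ` on the open unit disc matter. -/
structure IsInner (Θ : ℂ → Estar →L[ℂ] E) : Prop where
  analytic : DifferentiableOn ℂ Θ (Metric.ball 0 1)
  bounded : ∃ C : ℝ, ∀ z ∈ Metric.ball (0 : ℂ) 1, ‖Θ z‖ ≤ C
  boundary : ∀ x : Estar, ∀ᵐ θ : ℝ, ∃ y : E,
    Filter.Tendsto (fun r : ℝ => Θ ((r : ℂ) * Complex.exp (θ * Complex.I)) x)
      (𝓝[<] (1 : ℝ)) (𝓝 y) ∧ ‖y‖ = ‖x‖

/-- `(E_*, E, Θ)` is a Beurling–Lax–Halmos representation of `M`: `Θ` is inner and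
`M = Θ H²_{E_*}(𝔻)`. -/
structure IsBLHRepresentation (M : Submodule ℂ (Hardy E)) (Θ : ℂ → Estar →L[ℂ] E) : Prop where
  inner : IsInner Θ
  mul_mem : ∀ f : Hardy Estar, ∃ g ∈ M,
    ∀ z ∈ Metric.ball (0 : ℂ) 1, Hardy.eval g z = Θ z (Hardy.eval f z)
  exists_eq_mul : ∀ g ∈ M, ∃ f : Hardy Estar,
    ∀ z ∈ Metric.ball (0 : ℂ) 1, Hardy.eval g z = Θ z (Hardy.eval f z)

end Inner

/-! ### Taylor joint spectrum, tetrablock unitaries and tetrablock isometries -/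

section Tetrablock

variable {H : Type u} [NormedAddCommGroup H] [InnerProductSpace ℂ H]

/-- Exactness of the Koszul complex `0 → H → H³ → H³ → H → 0` of the triple `(T₁, T₂, T₃)`. The
maps are `h ↦ (T₁h, T₂h, T₃h)`,
`(h₁, h₂, h₃) ↦ (T₂h₃ - T₃h₂, T₃h₁ - T₁h₃, T₁h₂ - T₂h₁)` and
`(h₁, h₂, h₃) ↦ T₁h₁ + T₂h₂ + T₃h₃`. -/
structure KoszulExact (T₁ T₂ T₃ : H →L[ℂ] H) : Prop where
  exact₀ : ∀ h : H, T₁ h = 0 → T₂ h = 0 → T₃ h = 0 → h = 0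
  exact₁ : ∀ h₁ h₂ h₃ : H, T₂ h₃ - T₃ h₂ = 0 → T₃ h₁ - T₁ h₃ = 0 → T₁ h₂ - T₂ h₁ = 0 →
    ∃ h : H, T₁ h = h₁ ∧ T₂ h = h₂ ∧ T₃ h = h₃
  exact₂ : ∀ k₁ k₂ k₃ : H, T₁ k₁ + T₂ k₂ + T₃ k₃ = 0 →
    ∃ h₁ h₂ h₃ : H, T₂ h₃ - T₃ h₂ = k₁ ∧ T₃ h₁ - T₁ h₃ = k₂ ∧ T₁ h₂ - T₂ h₁ = k₃
  exact₃ : ∀ k : H, ∃ h₁ h₂ h₃ : H, T₁ h₁ + T₂ h₂ + T₃ h₃ = k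

/-- The Taylor joint spectrum of a commuting triple: the points `(x₁, x₂, x₃)` for which the Koszul
complex of `(A - x₁, B - x₂, P - x₃)` is not exact. -/
def taylorSpectrum (A B P : H →L[ℂ] H) : Set (ℂ × ℂ × ℂ) :=
  {x | ¬ KoszulExact (A - x.1 • ContinuousLinearMap.id ℂ H)
    (B - x.2.1 • ContinuousLinearMap.id ℂ H) (P - x.2.2 • ContinuousLinearMap.id ℂ H)}

/-- The distinguished boundary `bE` of the tetrablock. -/
def tetrablockBoundary : Set (ℂ × ℂ × ℂ) :=
  {x | x.1 = starRingEnd ℂ x.2.1 * x.2.2 ∧ ‖x.2.2‖ = 1 ∧ ‖x.2.1‖ ≤ 1}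

/-- A tetrablock unitary: a commuting triple of normal operators whose Taylor joint spectrum is
contained in `bE`. -/
structure IsTetrablockUnitary [CompleteSpace H] (A B P : H →L[ℂ] H) : Prop where
  comm_AB : Commute A B
  comm_AP : Commute A P
  comm_BP : Commute B P
  normal_A : IsStarNormal A
  normal_B : IsStarNormal B
  normal_P : IsStarNormal P
  spectrum_subset : taylorSpectrum A B P ⊆ tetrablockBoundary

/-- A tetrablock isometry: the restriction of a tetrablock unitary `(A', B', P')` on a Hilbert
space `K` to a joint invariant subspace. The inclusion of the subspace is the isometry `V`, whose
range is invariant because of the intertwining relations. -/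
def IsTetrablockIsometry (A B P : H →L[ℂ] H) : Prop :=
  ∃ (K : Type u) (_ : NormedAddCommGroup K) (_ : InnerProductSpace ℂ K) (_ : CompleteSpace K)
    (A' B' P' : K →L[ℂ] K) (V : H →ₗᵢ[ℂ] K),
    IsTetrablockUnitary A' B' P' ∧
      ∀ h : H, A' (V h) = V (A h) ∧ B' (V h) = V (B h) ∧ P' (V h) = V (P h)

end Tetrablock

end

/- Inner products in `H²` are limits, as `r → 1`, of averages over the circle of radius `r`, so the
isometric boundary values of `Θ` make multiplication by `Θ` an isometry `T : H²_{E_*} → H²_E` with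
range `M`, and `T` intertwines the two shifts. The operators `A = M_{F₁* + F₂ z}` and
`B = M_{F₂* + F₁ z}` commute with `M_z` and satisfy `A = B* M_z`, `B = A* M_z`. If `M` is invariant,
then `A T = T S₁` and `B T = T S₂`, and the relations between `A`, `B` and `M_z` descend to `S₁`,
`S₂` and the shift of `H²_{E_*}`. They force `S₁` to be multiplication by a polynomial of degree at
most one: `M_z* S₁ = S₂*`, and `S₂*` maps constants to constants because it commutes with `M_z*`. -/

/-! ### Circle averages of power series -/

section CircleAverage

open Real Metric

theorem circleAverage_conj_pow_mul_pow (m n : ℕ) (r : ℝ) :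
    circleAverage (fun z => starRingEnd ℂ (z ^ m) * z ^ n) 0 r =
      if n = m then (r : ℂ) ^ (2 * m) else 0 := by
  have hexp (θ : ℝ) : starRingEnd ℂ (circleMap 0 r θ ^ m) * circleMap 0 r θ ^ n =
      (r : ℂ) ^ (m + n) * Complex.exp (((n : ℤ) - (m : ℤ) : ℤ) * Complex.I * θ) := by
    rw [map_pow, conj_circleMap_zero, circleMap_zero_pow, circleMap_zero_pow, circleMap_zero_mul,
      circleMap_zero]
    push_cast
    ring_nf
  simp_rw [circleAverage, hexp, intervalIntegral.integral_const_mul]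
  split_ifs with h
  · subst h
    simp [← two_mul]
    field_simp
  · have hne : (((n : ℤ) - (m : ℤ) : ℤ) : ℂ) * Complex.I ≠ 0 :=
      mul_ne_zero (Int.cast_ne_zero.mpr (by omega)) Complex.I_ne_zero
    have hperiod : Complex.exp (((n : ℤ) - (m : ℤ) : ℤ) * Complex.I * (2 * π : ℝ)) = 1 := by
      rw [← Complex.exp_int_mul_two_pi_mul_I ((n : ℤ) - (m : ℤ))]
      push_cast
      ring_nf
    rw [integral_exp_mul_complex hne, hperiod]
    simp

theorem hasSum_circleAverage {E ι : Type*} [NormedAddCommGroup E] [NormedSpace ℝ E] [Countable ι]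
    {F : ι → ℂ → E} {f : ℂ → E} {u : ι → ℝ} {c : ℂ} {R : ℝ}
    (hF : ∀ i, ContinuousOn (F i) (sphere c |R|)) (hu : Summable u)
    (hFu : ∀ i, ∀ z ∈ sphere c |R|, ‖F i z‖ ≤ u i)
    (hf : ∀ z ∈ sphere c |R|, HasSum (fun i => F i z) (f z)) :
    HasSum (fun i => circleAverage (F i) c R) (circleAverage f c R) :=
  (intervalIntegral.hasSum_integral_of_dominated_convergence (fun i _ => u i)
    (fun i => ((hF i).comp_continuous (continuous_circleMap c R)
      (circleMap_mem_sphere' c R)).aestronglyMeasurable)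
    (fun i => .of_forall fun θ _ => hFu i _ (circleMap_mem_sphere' c R θ))
    (.of_forall fun _ _ => hu) intervalIntegrable_const
    (.of_forall fun θ _ => hf _ (circleMap_mem_sphere' c R θ))).const_smul _

variable {E : Type*} [NormedAddCommGroup E] [InnerProductSpace ℂ E] [CompleteSpace E]

theorem hasSum_pow_smul_of_mem_sphere {a : ℕ → E} {r : ℝ}
    (ha : Summable fun n => |r| ^ n * ‖a n‖) {z : ℂ} (hz : z ∈ sphere 0 |r|) :
    HasSum (fun n => z ^ n • a n) (∑' n, z ^ n • a n) := by
  refine (Summable.of_norm ?_).hasSum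
  simpa only [norm_smul, norm_pow, mem_sphere_zero_iff_norm.mp hz] using ha

theorem continuousOn_tsum_pow_smul {a : ℕ → E} {r : ℝ} (ha : Summable fun n => |r| ^ n * ‖a n‖) :
    ContinuousOn (fun z : ℂ => ∑' n, z ^ n • a n) (sphere 0 |r|) :=
  continuousOn_tsum (fun n => by fun_prop) ha fun n z hz => by
    rw [norm_smul, norm_pow, mem_sphere_zero_iff_norm.mp hz]

theorem circleAverage_conj_pow_smul_tsum {a : ℕ → E} {r : ℝ}
    (ha : Summable fun n => |r| ^ n * ‖a n‖) (m : ℕ) :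
    circleAverage (fun z => starRingEnd ℂ (z ^ m) • ∑' n, z ^ n • a n) 0 r =
      (r : ℂ) ^ (2 * m) • a m := by
  have hterm (n : ℕ) : circleAverage (fun z => starRingEnd ℂ (z ^ m) • z ^ n • a n) 0 r =
      if n = m then (r : ℂ) ^ (2 * m) • a m else 0 := by
    simp_rw [smul_smul]
    rw [circleAverage_def, intervalIntegral.integral_smul_const, ← smul_assoc,
      ← circleAverage_def (f := fun z => starRingEnd ℂ (z ^ m) * z ^ n),
      circleAverage_conj_pow_mul_pow, ite_smul, zero_smul]
    split_ifs with h
    · rw [h]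
    · rfl
  have hsum := hasSum_circleAverage (c := 0) (R := r)
    (F := fun n z => starRingEnd ℂ (z ^ m) • z ^ n • a n) (fun n => by fun_prop)
    (ha.mul_left (|r| ^ m)) (fun n z hz => by
      simp [norm_smul, mem_sphere_zero_iff_norm.mp hz])
    (fun z hz => (hasSum_pow_smul_of_mem_sphere ha hz).const_smul _)
  simp_rw [hterm] at hsum
  exact hsum.unique (hasSum_ite_eq m _)

theorem hasSum_circleAverage_inner {a b : ℕ → E} {r : ℝ}
    (ha : Summable fun n => |r| ^ n * ‖a n‖) (hb : Summable fun n => |r| ^ n * ‖b n‖) :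
    HasSum (fun n => (r : ℂ) ^ (2 * n) * inner ℂ (a n) (b n))
      (circleAverage (fun z => inner ℂ (∑' n, z ^ n • a n) (∑' n, z ^ n • b n)) 0 r) := by
  set g : ℂ → E := fun z => ∑' n, z ^ n • b n
  have hg : ContinuousOn g (sphere 0 |r|) := continuousOn_tsum_pow_smul hb
  obtain ⟨C, hC⟩ := (isCompact_sphere (0 : ℂ) |r|).exists_bound_of_continuousOn hg
  have hterm (n : ℕ) : circleAverage (fun z => inner ℂ (z ^ n • a n) (g z)) 0 r =
      (r : ℂ) ^ (2 * n) * inner ℂ (a n) (b n) := by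
    have hint : CircleIntegrable (fun z => starRingEnd ℂ (z ^ n) • g z) 0 r :=
      ContinuousOn.circleIntegrable' (by fun_prop)
    have hcomm := ((innerSL ℂ (a n)).restrictScalars ℝ).circleAverage_comp_comm hint
    rw [circleAverage_conj_pow_smul_tsum hb] at hcomm
    simpa only [Function.comp_def, ContinuousLinearMap.coe_restrictScalars', innerSL_apply_apply,
      inner_smul_left, inner_smul_right] using hcomm
  have hsum := hasSum_circleAverage (c := 0) (R := r)
    (F := fun n z => inner ℂ (z ^ n • a n) (g z))
    (f := fun z => inner ℂ (∑' n, z ^ n • a n) (g z)) (fun n => by fun_prop)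
    (ha.mul_right C) (fun n z hz => by
      refine (norm_inner_le_norm _ _).trans ?_
      rw [norm_smul, norm_pow, mem_sphere_zero_iff_norm.mp hz]
      exact mul_le_mul_of_nonneg_left (hC z hz) (by positivity))
    (fun z hz => (innerSLFlip ℂ (g z)).hasSum (hasSum_pow_smul_of_mem_sphere ha hz))
  simpa only [hterm] using hsum

end CircleAverage

/-! ### Evaluation on the Hardy space -/

namespace Hardy

open Filter Metric Real

theorem sphere_subset_ball {r : ℝ} (hr : r ∈ Set.Ioo 0 1) :
    sphere (0 : ℂ) |r| ⊆ ball 0 1 := fun z hz => by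
  rw [mem_ball_zero_iff, mem_sphere_zero_iff_norm.mp hz, abs_of_pos hr.1]
  exact hr.2

theorem circleMap_mem_ball {r : ℝ} (hr : r ∈ Set.Ioo 0 1) (θ : ℝ) : circleMap 0 r θ ∈ ball 0 1 :=
  sphere_subset_ball hr (circleMap_mem_sphere' 0 r θ)

variable {E : Type u} [NormedAddCommGroup E] [InnerProductSpace ℂ E]

theorem norm_eval_le (f : Hardy E) {z : ℂ} (hz : z ∈ ball 0 1) :
    ‖eval f z‖ ≤ (∑' n : ℕ, ‖z‖ ^ n) * ‖f‖ := by
  have hgeom := summable_geometric_of_lt_one (norm_nonneg z) (mem_ball_zero_iff.mp hz)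
  rw [← tsum_mul_right]
  refine tsum_of_norm_bounded (hgeom.mul_right ‖f‖).hasSum fun n => ?_
  rw [norm_smul, norm_pow]
  gcongr
  exact lp.norm_apply_le_norm two_ne_zero f n

theorem eval_single (k : ℕ) (x : E) (z : ℂ) : eval (lp.single 2 k x : Hardy E) z = z ^ k • x := by
  rw [eval, tsum_eq_single k fun n hn => by simp [hn]]
  simp

theorem summable_abs_pow_mul_norm {r : ℝ} (hr : r ∈ Set.Ioo 0 1) (f : Hardy E) :
    Summable fun n => |r| ^ n * ‖f n‖ := by
  simpa [norm_smul] using summable_norm_eval f (circleMap_mem_ball hr 0)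

variable [CompleteSpace E]

theorem eval_add (f g : Hardy E) {z : ℂ} (hz : z ∈ ball 0 1) :
    eval (f + g) z = eval f z + eval g z := by
  simp_rw [eval, lp.coeFn_add, Pi.add_apply, smul_add]
  exact (summable_eval f hz).tsum_add (summable_eval g hz)

theorem eval_smul (c : ℂ) (f : Hardy E) {z : ℂ} (hz : z ∈ ball 0 1) :
    eval (c • f) z = c • eval f z := by
  simp_rw [eval, lp.coeFn_smul, Pi.smul_apply, smul_comm _ c]
  exact (summable_eval f hz).tsum_const_smul c

/-- Evaluation at a point of the disc as a bounded operator. -/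
noncomputable def evalCLM {z : ℂ} (hz : z ∈ ball 0 1) : Hardy E →L[ℂ] E :=
  LinearMap.mkContinuous
    { toFun := fun f => eval f z
      map_add' := fun f g => eval_add f g hz
      map_smul' := fun c f => eval_smul c f hz }
    (∑' n : ℕ, ‖z‖ ^ n) fun f => norm_eval_le f hz

@[simp]
theorem evalCLM_apply {z : ℂ} (hz : z ∈ ball 0 1) (f : Hardy E) : evalCLM hz f = eval f z := rfl

theorem ext_eval {f g : Hardy E} (h : Set.EqOn (eval f) (eval g) (ball 0 1)) : f = g := by
  ext n
  obtain ⟨r, hr⟩ := Set.nonempty_Ioo.mpr (zero_lt_one' ℝ)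
  have hcoeff (u : Hardy E) : circleAverage (fun z => starRingEnd ℂ (z ^ n) • eval u z) 0 r =
      (r : ℂ) ^ (2 * n) • u n :=
    circleAverage_conj_pow_smul_tsum (summable_abs_pow_mul_norm hr u) n
  have heq : (r : ℂ) ^ (2 * n) • f n = (r : ℂ) ^ (2 * n) • g n := by
    rw [← hcoeff, ← hcoeff]
    refine circleAverage_congr_sphere fun z hz => ?_
    simp only [h (sphere_subset_ball hr hz)]
  exact smul_right_injective E (pow_ne_zero _ (Complex.ofReal_ne_zero.mpr hr.1.ne')) heq

theorem tendsto_circleAverage_inner_eval (f g : Hardy E) :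
    Tendsto (fun r => circleAverage (fun z => inner ℂ (eval f z) (eval g z)) 0 r) (𝓝[<] 1)
      (𝓝 (inner ℂ f g)) := by
  have hIoo : Set.Ioo (0 : ℝ) 1 ∈ 𝓝[<] 1 := Ioo_mem_nhdsLT zero_lt_one
  have hsum : Tendsto (fun r : ℝ => ∑' n, (r : ℂ) ^ (2 * n) * inner ℂ (f n) (g n)) (𝓝[<] 1)
      (𝓝 (inner ℂ f g)) := by
    rw [lp.inner_eq_tsum]
    refine tendsto_tsum_of_dominated_convergence (lp.summable_inner (𝕜 := ℂ) f g).norm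
      (fun n => ?_) ?_
    · have hcont : Continuous fun r : ℝ => (r : ℂ) ^ (2 * n) * inner ℂ (f n) (g n) := by fun_prop
      simpa using (hcont.tendsto 1).mono_left nhdsWithin_le_nhds
    · filter_upwards [hIoo] with r hr n
      rw [norm_mul, norm_pow, Complex.norm_real, norm_of_nonneg hr.1.le]
      exact mul_le_of_le_one_left (norm_nonneg _) (pow_le_one₀ hr.1.le hr.2.le)
  refine hsum.congr' ?_
  filter_upwards [hIoo] with r hr
  exact (hasSum_circleAverage_inner (summable_abs_pow_mul_norm hr f)
    (summable_abs_pow_mul_norm hr g)).tsum_eq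

end Hardy

/-! ### Inner functions -/

namespace IsInner

open Filter Hardy MeasureTheory Metric Real

variable {E Estar : Type u}
  [NormedAddCommGroup E] [InnerProductSpace ℂ E]
  [NormedAddCommGroup Estar] [InnerProductSpace ℂ Estar]
  {Θ : ℂ → Estar →L[ℂ] E}

theorem tendsto_norm_sq (hΘ : IsInner Θ) (x : Estar) : ∀ᵐ θ : ℝ,
    Tendsto (fun r => (‖Θ (circleMap 0 r θ) x‖ : ℂ) ^ 2) (𝓝[<] 1) (𝓝 ((‖x‖ : ℂ) ^ 2)) := by
  filter_upwards [hΘ.boundary x] with θ ⟨y, hy, hyx⟩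
  simp_rw [circleMap_zero, ← hyx]
  exact ((Complex.continuous_ofReal.tendsto _).comp hy.norm).pow 2

theorem tendsto_inner (hΘ : IsInner Θ) (x y : Estar) : ∀ᵐ θ : ℝ,
    Tendsto (fun r => inner ℂ (Θ (circleMap 0 r θ) x) (Θ (circleMap 0 r θ) y)) (𝓝[<] 1)
      (𝓝 (inner ℂ x y)) := by
  filter_upwards [hΘ.tendsto_norm_sq (x + y), hΘ.tendsto_norm_sq (x - y),
    hΘ.tendsto_norm_sq (x - (RCLike.I : ℂ) • y), hΘ.tendsto_norm_sq (x + (RCLike.I : ℂ) • y)]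
    with θ h₁ h₂ h₃ h₄
  simp_rw [inner_eq_sum_norm_sq_div_four, ← map_smul, ← map_add, ← map_sub]
  exact ((h₁.sub h₂).add ((h₃.sub h₄).mul_const _)).div_const _

theorem tendsto_circleAverage_mul_inner (hΘ : IsInner Θ) {φ : ℂ → ℂ} (hφ : Continuous φ)
    (x y : Estar) :
    Tendsto (fun r => circleAverage (fun z => φ z * inner ℂ (Θ z x) (Θ z y)) 0 r) (𝓝[<] 1)
      (𝓝 (circleAverage φ 0 1 * inner ℂ x y)) := by
  obtain ⟨C, hC⟩ := hΘ.bounded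
  obtain ⟨D, hD⟩ := (isCompact_closedBall (0 : ℂ) 1).exists_bound_of_continuousOn hφ.continuousOn
  have hIoo : Set.Ioo (0 : ℝ) 1 ∈ 𝓝[<] 1 := Ioo_mem_nhdsLT zero_lt_one
  have hlim : circleAverage φ 0 1 * inner ℂ x y =
      circleAverage (fun z => φ z * inner ℂ x y) 0 1 := by
    simp only [circleAverage_def, intervalIntegral.integral_mul_const, smul_mul_assoc]
  rw [hlim]
  refine Tendsto.const_smul (intervalIntegral.tendsto_integral_filter_of_dominated_convergence
    (fun _ => D * (C * ‖x‖ * (C * ‖y‖))) ?_ ?_ intervalIntegrable_const ?_) _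
  · filter_upwards [hIoo] with r hr
    have hΘr : Continuous fun θ => Θ (circleMap 0 r θ) :=
      hΘ.analytic.continuousOn.comp_continuous (continuous_circleMap 0 r) (circleMap_mem_ball hr)
    exact ((hφ.comp (continuous_circleMap 0 r)).mul ((hΘr.clm_apply continuous_const).inner
      (hΘr.clm_apply continuous_const))).aestronglyMeasurable
  · filter_upwards [hIoo] with r hr
    refine .of_forall fun θ _ => ?_
    have hz := circleMap_mem_ball hr θ
    have hbound (u : Estar) : ‖Θ (circleMap 0 r θ) u‖ ≤ C * ‖u‖ := (Θ _).le_of_opNorm_le (hC _ hz) u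
    rw [norm_mul]
    gcongr
    · exact (norm_nonneg _).trans (hD _ (ball_subset_closedBall hz))
    · exact hD _ (ball_subset_closedBall hz)
    · refine (norm_inner_le_norm _ _).trans ?_
      gcongr
      · exact (norm_nonneg _).trans (hbound x)
      · exact hbound x
      · exact hbound y
  · filter_upwards [hΘ.tendsto_inner x y] with θ hθ _
    have hcont : Continuous fun r => φ (circleMap 0 r θ) := by
      simp only [circleMap]
      fun_prop
    exact ((hcont.tendsto 1).mono_left nhdsWithin_le_nhds).mul hθ

end IsInner

/-! ### Multiplication operators between Hardy spaces -/

namespace Hardy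

open Filter Metric Real

variable {E F : Type u} [NormedAddCommGroup E] [InnerProductSpace ℂ E]
  [NormedAddCommGroup F] [InnerProductSpace ℂ F]

/-- `T` is the operator of multiplication by the operator-valued function `Θ` on the disc. Only
the values of `Θ` on the open disc matter, and `Θ` need not be bounded or analytic a priori. -/
def IsMultiplication (Θ : ℂ → E →L[ℂ] F) (T : Hardy E →L[ℂ] Hardy F) : Prop :=
  ∀ f, ∀ z ∈ ball (0 : ℂ) 1, eval (T f) z = Θ z (eval f z)

theorem IsMultiplication.comp {G : Type u} [NormedAddCommGroup G] [InnerProductSpace ℂ G]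
    {Φ : ℂ → F →L[ℂ] G} {S : Hardy F →L[ℂ] Hardy G} {Θ : ℂ → E →L[ℂ] F}
    {T : Hardy E →L[ℂ] Hardy F} (hS : IsMultiplication Φ S) (hT : IsMultiplication Θ T) :
    IsMultiplication (fun z => Φ z ∘L Θ z) (S ∘L T) := fun f z hz => by
  rw [ContinuousLinearMap.comp_apply, hS _ z hz, hT f z hz, ContinuousLinearMap.comp_apply]

theorem IsMultiplication.eq_iff [CompleteSpace F] {Θ Θ' : ℂ → E →L[ℂ] F}
    {T T' : Hardy E →L[ℂ] Hardy F} (hT : IsMultiplication Θ T) (hT' : IsMultiplication Θ' T') :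
    T = T' ↔ Set.EqOn Θ Θ' (ball 0 1) := by
  refine ⟨fun h z hz => ?_, fun h => ?_⟩
  · ext x
    have heval := hT (lp.single 2 0 x) z hz
    rw [h, hT' _ z hz, eval_single, pow_zero, one_smul] at heval
    exact heval.symm
  · ext1 f
    exact ext_eval fun z hz => by rw [hT f z hz, hT' f z hz, h hz]

theorem isMultiplication_Mlin [CompleteSpace E] (A B : E →L[ℂ] E) :
    IsMultiplication (fun z => A + z • B) (Mlin A B) :=
  fun f _ hz => eval_Mlin A B f hz

theorem isMultiplication_Mz [CompleteSpace E] :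
    IsMultiplication (fun z => z • ContinuousLinearMap.id ℂ E) (Mz E) :=
  fun f _ hz => eval_Mz f hz

theorem IsMultiplication.inner_single_single [CompleteSpace F] {Θ : ℂ → E →L[ℂ] F}
    {T : Hardy E →L[ℂ] Hardy F} (hT : IsMultiplication Θ T) (hΘ : IsInner Θ)
    (k n : ℕ) (x y : E) :
    inner ℂ (T (lp.single 2 k x)) (T (lp.single 2 n y)) =
      inner ℂ (lp.single 2 k x : Hardy E) (lp.single 2 n y) := by
  have hlim := hΘ.tendsto_circleAverage_mul_inner
    (φ := fun z => starRingEnd ℂ (z ^ k) * z ^ n) (by fun_prop) x y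
  refine tendsto_nhds_unique (tendsto_circleAverage_inner_eval _ _)
    ((hlim.congr' ?_).trans_eq (congrArg 𝓝 ?_))
  · filter_upwards [Ioo_mem_nhdsLT zero_lt_one] with r hr
    refine circleAverage_congr_sphere fun z hz => ?_
    simp only [hT _ z (sphere_subset_ball hr hz), eval_single, map_smul, inner_smul_left,
      inner_smul_right]
    ring
  · rw [circleAverage_conj_pow_mul_pow, lp.inner_single_left, lp.coeFn_single, Pi.single_apply]
    rcases eq_or_ne n k with rfl | hnk
    · simp
    · simp [hnk, hnk.symm]

variable [CompleteSpace E] [CompleteSpace F] {Θ : ℂ → E →L[ℂ] F} {T : Hardy E →L[ℂ] Hardy F}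

theorem IsMultiplication.Mz_comp (hT : IsMultiplication Θ T) : Mz F ∘L T = T ∘L Mz E :=
  ((isMultiplication_Mz.comp hT).eq_iff (hT.comp isMultiplication_Mz)).mpr fun z _ => by
    ext x
    simp

theorem IsMultiplication.Mlin_comp_eq_iff (hT : IsMultiplication Θ T) (A B : F →L[ℂ] F)
    (C D : E →L[ℂ] E) :
    Mlin A B ∘L T = T ∘L Mlin C D ↔
      ∀ z ∈ ball (0 : ℂ) 1, (A + z • B) ∘L Θ z = Θ z ∘L (C + z • D) :=
  ((isMultiplication_Mlin A B).comp hT).eq_iff (hT.comp (isMultiplication_Mlin C D))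

theorem exists_isMultiplication
    (h : ∀ f : Hardy E, ∃ g : Hardy F, ∀ z ∈ ball (0 : ℂ) 1, eval g z = Θ z (eval f z)) :
    ∃ T, IsMultiplication Θ T := by
  choose T hT using h
  let L : Hardy E →ₗ[ℂ] Hardy F :=
    { toFun := T
      map_add' := fun f g => ext_eval fun z hz => by
        simp only [hT _ z hz, eval_add _ _ hz, map_add]
      map_smul' := fun c f => ext_eval fun z hz => by
        simp only [hT _ z hz, eval_smul _ _ hz, map_smul, RingHom.id_apply] }
  have hL : Continuous L := by
    refine L.continuous_of_seq_closed_graph fun u f g hu hLu => ext_eval fun z hz => ?_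
    have hg : Tendsto (fun n => Θ z (eval (u n) z)) atTop (𝓝 (eval g z)) := by
      simpa [L, Function.comp_def, hT _ z hz] using ((evalCLM hz).continuous.tendsto g).comp hLu
    have hf : Tendsto (fun n => Θ z (eval (u n) z)) atTop (𝓝 (Θ z (eval f z))) :=
      ((Θ z ∘L evalCLM hz).continuous.tendsto f).comp hu
    exact (tendsto_nhds_unique hg hf).trans (hT f z hz).symm
  exact ⟨⟨L, hL⟩, hT⟩

theorem IsMultiplication.adjoint_comp_self (hT : IsMultiplication Θ T) (hΘ : IsInner Θ) :
    T† ∘L T = 1 := by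
  refine lp.ext_continuousLinearMap ENNReal.ofNat_ne_top fun k => ?_
  ext x n
  refine ext_inner_right ℂ fun y => ?_
  have h := hT.inner_single_single hΘ k n x y
  rw [← ContinuousLinearMap.adjoint_inner_left, lp.inner_single_right, lp.inner_single_right] at h
  exact h

end Hardy

theorem IsBLHRepresentation.exists_isMultiplication {E Estar : Type u}
    [NormedAddCommGroup E] [InnerProductSpace ℂ E] [CompleteSpace E]
    [NormedAddCommGroup Estar] [InnerProductSpace ℂ Estar] [CompleteSpace Estar]
    {M : Submodule ℂ (Hardy E)} {Θ : ℂ → Estar →L[ℂ] E} (hΘ : IsBLHRepresentation M Θ) :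
    ∃ T, Hardy.IsMultiplication Θ T ∧ T† ∘L T = 1 ∧ T.range = M := by
  obtain ⟨T, hT⟩ := Hardy.exists_isMultiplication fun f =>
    (hΘ.mul_mem f).imp fun _ hg => hg.2
  refine ⟨T, hT, hT.adjoint_comp_self hΘ.inner, le_antisymm ?_ fun g hg => ?_⟩
  · rintro _ ⟨f, rfl⟩
    obtain ⟨g, hgM, hg⟩ := hΘ.mul_mem f
    rwa [ContinuousLinearMap.coe_coe, Hardy.ext_eval fun z hz => (hT f z hz).trans (hg z hz).symm]
  · obtain ⟨f, hf⟩ := hΘ.exists_eq_mul g hg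
    exact ⟨f, Hardy.ext_eval fun z hz => (hT f z hz).trans (hf z hz).symm⟩

/-! ### Operators commuting with the shift -/

namespace Hardy

open ContinuousLinearMap

section Constants

variable {E : Type u} [NormedAddCommGroup E] [InnerProductSpace ℂ E]

/-- The embedding of `E` into `H²_E(𝔻)` as the space of constant functions. -/
noncomputable def const : E →L[ℂ] Hardy E :=
  lp.singleContinuousLinearMap ℂ (fun _ : ℕ => E) 2 0

@[simp]
theorem const_apply_zero (x : E) : const x 0 = x := by simp [const]

@[simp]
theorem const_apply_succ (x : E) (n : ℕ) : const x (n + 1) = 0 := by simp [const]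

theorem Mz_single (k : ℕ) (x : E) :
    Mz E (lp.single 2 k x) = (lp.single 2 (k + 1) x : Hardy E) := by
  ext n
  cases n <;> simp [Pi.single_apply]

theorem Mlin_const (A B : E →L[ℂ] E) (x : E) :
    Mlin A B (const x) = const (A x) + Mz E (const (B x)) := by
  ext n
  rcases n with _ | _ | n <;> simp [Mlin]

theorem Mlin_inj {A B C D : E →L[ℂ] E} : Mlin A B = Mlin C D ↔ A = C ∧ B = D := by
  refine ⟨fun h => ?_, fun ⟨hA, hB⟩ => by rw [hA, hB]⟩
  have hcoeff (x : E) (n : ℕ) := congrArg (fun S => S (const x) n) h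
  simp only [Mlin_const] at hcoeff
  exact ⟨ext fun x => by simpa using hcoeff x 0, ext fun x => by simpa using hcoeff x 1⟩

theorem ext_of_comp_Mz {S T : Hardy E →L[ℂ] Hardy E} (hS : Mz E ∘L S = S ∘L Mz E)
    (hT : Mz E ∘L T = T ∘L Mz E) (h : S ∘L const = T ∘L const) : S = T := by
  refine lp.ext_continuousLinearMap ENNReal.ofNat_ne_top fun k => ?_
  induction k with
  | zero => exact h
  | succ k ih =>
    ext1 x
    have hk : S (lp.single 2 k x) = T (lp.single 2 k x) := DFunLike.congr_fun ih x
    have hSk := DFunLike.congr_fun hS (lp.single 2 k x)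
    have hTk := DFunLike.congr_fun hT (lp.single 2 k x)
    simp only [comp_apply, Mz_single, hk] at hSk hTk
    exact hSk.symm.trans hTk

theorem Mz_comp_Mconst (A : E →L[ℂ] E) : Mz E ∘L Mconst A = Mconst A ∘L Mz E := by
  ext f n
  cases n <;> simp

end Constants

variable {E : Type u} [NormedAddCommGroup E] [InnerProductSpace ℂ E] [CompleteSpace E]

theorem adjoint_Mz_apply (f : Hardy E) (n : ℕ) : ((Mz E)†) f n = f (n + 1) := by
  refine ext_inner_right ℂ fun y => ?_
  rw [← lp.inner_single_right, ← lp.inner_single_right, ← Mz_single]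
  exact adjoint_inner_left _ _ _

theorem adjoint_const_apply (f : Hardy E) : (const†) f = f 0 := by
  refine ext_inner_right ℂ fun y => ?_
  rw [adjoint_inner_left, ← lp.inner_single_right]
  rfl

theorem adjoint_Mz_comp_self : (Mz E)† ∘L Mz E = 1 := by
  ext f n
  exact adjoint_Mz_apply _ n

theorem adjoint_Mz_const (x : E) : ((Mz E)†) (const x) = 0 := by
  ext n
  rw [adjoint_Mz_apply, const_apply_succ]
  rfl

theorem const_adjoint_add_Mz_adjoint (f : Hardy E) :
    const ((const†) f) + Mz E (((Mz E)†) f) = f := by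
  ext n
  cases n <;> simp [adjoint_Mz_apply, adjoint_const_apply]

theorem adjoint_Mconst (A : E →L[ℂ] E) : (Mconst A)† = Mconst (A†) := by
  refine ((eq_adjoint_iff _ _).mpr fun f g => ?_).symm
  simp_rw [lp.inner_eq_tsum, Mconst_apply, adjoint_inner_left]

theorem Mlin_adjoint_eq (A B : E →L[ℂ] E) : Mlin (A†) B = (Mlin (B†) A)† ∘L Mz E := by
  rw [Mlin, Mlin, map_add, adjoint_comp, adjoint_Mconst, adjoint_Mconst, adjoint_adjoint, add_comp,
    comp_assoc, adjoint_Mz_comp_self, one_def, comp_id, Mz_comp_Mconst, add_comm]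

/-- The compression of an operator on `H²_E(𝔻)` to the space of constant functions. -/
noncomputable def compressConst (S : Hardy E →L[ℂ] Hardy E) : E →L[ℂ] E :=
  const† ∘L S ∘L const

theorem compressConst_adjoint (S : Hardy E →L[ℂ] Hardy E) :
    compressConst (S†) = (compressConst S)† := by
  simp only [compressConst, adjoint_comp, adjoint_adjoint, comp_assoc]

theorem adjoint_apply_const {S : Hardy E →L[ℂ] Hardy E} (hS : Mz E ∘L S = S ∘L Mz E) (x : E) :
    (S†) (const x) = const (((compressConst S)†) x) := by
  have hcomm : (Mz E)† ∘L S† = S† ∘L (Mz E)† := by rw [← adjoint_comp, ← adjoint_comp, hS]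
  have hzero : ((Mz E)†) ((S†) (const x)) = 0 := by
    rw [← comp_apply, hcomm, comp_apply, adjoint_Mz_const, map_zero]
  rw [← const_adjoint_add_Mz_adjoint ((S†) (const x)), hzero, map_zero, add_zero,
    ← compressConst_adjoint]
  rfl

theorem eq_Mlin_of_eq_adjoint_comp_Mz {S₁ S₂ : Hardy E →L[ℂ] Hardy E}
    (h₁ : Mz E ∘L S₁ = S₁ ∘L Mz E) (h₂ : Mz E ∘L S₂ = S₂ ∘L Mz E) (h : S₁ = S₂† ∘L Mz E) :
    S₁ = Mlin (compressConst S₁) ((compressConst S₂)†) := by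
  refine ext_of_comp_Mz h₁ (isMultiplication_Mlin _ _).Mz_comp (ext fun x => ?_)
  have hshift : (Mz E)† ∘L S₁ = S₂† := by
    rw [h, ← comp_assoc, ← adjoint_comp, ← h₂, adjoint_comp, comp_assoc, adjoint_Mz_comp_self]
    rfl
  calc S₁ (const x)
      = const (compressConst S₁ x) + Mz E (((Mz E)† ∘L S₁) (const x)) :=
        (const_adjoint_add_Mz_adjoint _).symm
    _ = Mlin (compressConst S₁) ((compressConst S₂)†) (const x) := by
        rw [hshift, adjoint_apply_const h₂, Mlin_const]

end Hardy

/-! ### Descent along an isometry -/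

section Isometry

open ContinuousLinearMap

theorem mapsTo_range_of_comp_eq_comp {R X Y : Type*} [Semiring R]
    [AddCommMonoid X] [Module R X] [TopologicalSpace X]
    [AddCommMonoid Y] [Module R Y] [TopologicalSpace Y]
    {T : X →L[R] Y} {A : Y →L[R] Y} {S : X →L[R] X} (h : A ∘L T = T ∘L S) :
    Set.MapsTo A T.range T.range := by
  rintro _ ⟨x, rfl⟩
  exact ⟨S x, (DFunLike.congr_fun h x).symm⟩

variable {𝕜 H K : Type*} [RCLike 𝕜] [NormedAddCommGroup H] [InnerProductSpace 𝕜 H]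
  [CompleteSpace H] [NormedAddCommGroup K] [InnerProductSpace 𝕜 K] [CompleteSpace K]
  {T : H →L[𝕜] K}

theorem comp_left_inj_of_adjoint_comp_self (hT : adjoint T ∘L T = 1) {L : Type*}
    [NormedAddCommGroup L] [NormedSpace 𝕜 L] {S S' : L →L[𝕜] H} : T ∘L S = T ∘L S' ↔ S = S' := by
  refine ⟨fun h => ?_, fun h => by rw [h]⟩
  have hadj := congrArg (adjoint T ∘L ·) h
  simpa only [← comp_assoc, hT, one_def, id_comp] using hadj

theorem exists_comp_eq_comp_of_mapsTo_range (hT : adjoint T ∘L T = 1) {A : K →L[𝕜] K}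
    (hA : Set.MapsTo A T.range T.range) : ∃ S, A ∘L T = T ∘L S := by
  refine ⟨adjoint T ∘L A ∘L T, ext fun x => ?_⟩
  obtain ⟨y, hy⟩ := hA ⟨x, rfl⟩
  have hTy : adjoint T (T y) = y := DFunLike.congr_fun hT y
  simp only [comp_apply, coe_coe] at hy ⊢
  rw [← hy, hTy]

end Isometry

namespace Hardy

open ContinuousLinearMap

variable {E F : Type u}
  [NormedAddCommGroup E] [InnerProductSpace ℂ E] [CompleteSpace E]
  [NormedAddCommGroup F] [InnerProductSpace ℂ F] [CompleteSpace F]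
  {T : Hardy E →L[ℂ] Hardy F} {A B : Hardy F →L[ℂ] Hardy F} {S S₁ S₂ : Hardy E →L[ℂ] Hardy E}

theorem Mz_comp_of_comp_eq_comp (hT : T† ∘L T = 1) (hTz : Mz F ∘L T = T ∘L Mz E)
    (hA : Mz F ∘L A = A ∘L Mz F) (hS : A ∘L T = T ∘L S) : Mz E ∘L S = S ∘L Mz E :=
  (comp_left_inj_of_adjoint_comp_self hT).mp <| calc
    T ∘L Mz E ∘L S
    _ = Mz F ∘L A ∘L T := by rw [← comp_assoc, ← hTz, comp_assoc, ← hS]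
    _ = A ∘L T ∘L Mz E := by rw [← comp_assoc, hA, comp_assoc, hTz]
    _ = T ∘L S ∘L Mz E := by rw [← comp_assoc, hS, comp_assoc]

theorem eq_adjoint_comp_Mz_of_comp_eq_comp (hT : T† ∘L T = 1) (hTz : Mz F ∘L T = T ∘L Mz E)
    (hAB : A = B† ∘L Mz F) (h₁ : A ∘L T = T ∘L S₁) (h₂ : B ∘L T = T ∘L S₂) :
    S₁ = S₂† ∘L Mz E := calc
  S₁ = T† ∘L A ∘L T := by rw [h₁, ← comp_assoc, hT, one_def, id_comp]
  _ = (B ∘L T)† ∘L T ∘L Mz E := by rw [hAB, comp_assoc, hTz, adjoint_comp, comp_assoc]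
  _ = S₂† ∘L (T† ∘L T) ∘L Mz E := by rw [h₂, adjoint_comp, comp_assoc, comp_assoc]
  _ = S₂† ∘L Mz E := by rw [hT, one_def, id_comp]

theorem exists_comp_eq_comp_Mlin (hT : T† ∘L T = 1) (hTz : Mz F ∘L T = T ∘L Mz E)
    (hAz : Mz F ∘L A = A ∘L Mz F) (hBz : Mz F ∘L B = B ∘L Mz F)
    (hAB : A = B† ∘L Mz F) (hBA : B = A† ∘L Mz F)
    (hA : Set.MapsTo A T.range T.range) (hB : Set.MapsTo B T.range T.range) :
    ∃ G₁ G₂ : E →L[ℂ] E,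
      A ∘L T = T ∘L Mlin G₁ (G₂†) ∧ B ∘L T = T ∘L Mlin G₂ (G₁†) := by
  obtain ⟨S₁, h₁⟩ := exists_comp_eq_comp_of_mapsTo_range hT hA
  obtain ⟨S₂, h₂⟩ := exists_comp_eq_comp_of_mapsTo_range hT hB
  have c₁ := Mz_comp_of_comp_eq_comp hT hTz hAz h₁
  have c₂ := Mz_comp_of_comp_eq_comp hT hTz hBz h₂
  refine ⟨compressConst S₁, compressConst S₂, ?_, ?_⟩
  · rw [← eq_Mlin_of_eq_adjoint_comp_Mz c₁ c₂
      (eq_adjoint_comp_Mz_of_comp_eq_comp hT hTz hAB h₁ h₂), h₁]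
  · rw [← eq_Mlin_of_eq_adjoint_comp_Mz c₂ c₁
      (eq_adjoint_comp_Mz_of_comp_eq_comp hT hTz hBA h₂ h₁), h₂]

end Hardy

open ContinuousLinearMap in
theorem IsTetrablockIsometry.of_comp_eq_comp {H K : Type u}
    [NormedAddCommGroup H] [InnerProductSpace ℂ H] [NormedAddCommGroup K] [InnerProductSpace ℂ K]
    {A' B' P' : K →L[ℂ] K} (h : IsTetrablockIsometry A' B' P') {A B P : H →L[ℂ] H}
    {T : H →L[ℂ] K} (hT : ∀ x, ‖T x‖ = ‖x‖) (hA : A' ∘L T = T ∘L A) (hB : B' ∘L T = T ∘L B)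
    (hP : P' ∘L T = T ∘L P) : IsTetrablockIsometry A B P := by
  obtain ⟨L, i₁, i₂, i₃, A'', B'', P'', V, hU, hV⟩ := h
  refine ⟨L, i₁, i₂, i₃, A'', B'', P'', V.comp ⟨T.toLinearMap, hT⟩, hU, fun x => ?_⟩
  have hVT := hV (T x)
  rw [← comp_apply A', ← comp_apply B', ← comp_apply P', hA, hB, hP] at hVT
  exact hVT

theorem theorem3p1 {E Estar : Type u}
    [NormedAddCommGroup E] [InnerProductSpace ℂ E] [CompleteSpace E]
    [NormedAddCommGroup Estar] [InnerProductSpace ℂ Estar] [CompleteSpace Estar]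
    (F₁ F₂ : E →L[ℂ] E)
    (M : Submodule ℂ (Hardy E)) (hM_closed : IsClosed (M : Set (Hardy E))) (hM_ne : M ≠ ⊥)
    (Θ : ℂ → Estar →L[ℂ] E) (hΘ : IsBLHRepresentation M Θ) :
    ((∀ f ∈ M, Hardy.Mlin (F₁†) F₂ f ∈ M ∧ Hardy.Mlin (F₂†) F₁ f ∈ M ∧
          Hardy.Mz E f ∈ M) ↔
      ∃! G : (Estar →L[ℂ] Estar) × (Estar →L[ℂ] Estar), ∀ z ∈ Metric.ball (0 : ℂ) 1,
        (F₁† + z • F₂) ∘L Θ z = Θ z ∘L (G.1 + z • (G.2)†) ∧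
        (F₂† + z • F₁) ∘L Θ z = Θ z ∘L (G.2 + z • (G.1)†)) ∧
    (IsTetrablockIsometry (Hardy.Mlin (F₁†) F₂) (Hardy.Mlin (F₂†) F₁)
        (Hardy.Mz E) →
      ∀ G₁ G₂ : Estar →L[ℂ] Estar,
        (∀ z ∈ Metric.ball (0 : ℂ) 1,
          (F₁† + z • F₂) ∘L Θ z = Θ z ∘L (G₁ + z • G₂†) ∧
          (F₂† + z • F₁) ∘L Θ z = Θ z ∘L (G₂ + z • G₁†)) →
        IsTetrablockIsometry (Hardy.Mlin G₁ (G₂†)) (Hardy.Mlin G₂ (G₁†))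
          (Hardy.Mz Estar)) := by
  obtain ⟨T, hTΘ, hT, hTM⟩ := hΘ.exists_isMultiplication
  have hiff (G₁ G₂ : Estar →L[ℂ] Estar) : (∀ z ∈ Metric.ball (0 : ℂ) 1,
        (F₁† + z • F₂) ∘L Θ z = Θ z ∘L (G₁ + z • G₂†) ∧
        (F₂† + z • F₁) ∘L Θ z = Θ z ∘L (G₂ + z • G₁†)) ↔
      Hardy.Mlin (F₁†) F₂ ∘L T = T ∘L Hardy.Mlin G₁ (G₂†) ∧
        Hardy.Mlin (F₂†) F₁ ∘L T = T ∘L Hardy.Mlin G₂ (G₁†) := by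
    rw [hTΘ.Mlin_comp_eq_iff, hTΘ.Mlin_comp_eq_iff, forall₂_and]
  simp only [hiff]
  subst hTM
  refine ⟨⟨fun h => ?_, fun ⟨_, ⟨h₁, h₂⟩, _⟩ f hf => ?_⟩, fun h G₁ G₂ hG => ?_⟩
  · obtain ⟨G₁, G₂, h₁, h₂⟩ := Hardy.exists_comp_eq_comp_Mlin hT hTΘ.Mz_comp
      (Hardy.isMultiplication_Mlin _ _).Mz_comp (Hardy.isMultiplication_Mlin _ _).Mz_comp
      (Hardy.Mlin_adjoint_eq F₁ F₂) (Hardy.Mlin_adjoint_eq F₂ F₁)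
      (fun f hf => (h f hf).1) (fun f hf => (h f hf).2.1)
    refine ⟨(G₁, G₂), ⟨h₁, h₂⟩, fun G' hG' => ?_⟩
    rw [h₁, h₂, comp_left_inj_of_adjoint_comp_self hT, comp_left_inj_of_adjoint_comp_self hT,
      Hardy.Mlin_inj, Hardy.Mlin_inj] at hG'
    exact Prod.ext hG'.1.1.symm hG'.2.1.symm
  · exact ⟨mapsTo_range_of_comp_eq_comp h₁ hf, mapsTo_range_of_comp_eq_comp h₂ hf,
      mapsTo_range_of_comp_eq_comp hTΘ.Mz_comp hf⟩
  · exact h.of_comp_eq_comp (T.norm_map_iff_adjoint_comp_self.mpr hT) hG.1 hG.2 hTΘ.Mz_comp
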